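/- Let $k\ge 1$ and $m>1$ be integers. For $1\le i\le k$ let $R_i=(i^{\,k+1-i})$ be the rectangular partition with $k+1-i$ parts equal to $i$ (its largest hook length is $k$). For partitions $\lambda,\mu$ let $\lambda\cup\mu$ be the partition obtained by combining the parts of $\lambda$ and $\mu$ and placing them into non-increasing order, and write $\lambda\subseteq\mu$ for containment of Young diagrams. Let $Y^k_m$ be the set of all $k$-bounded partitions $\lambda$ (all parts at most $k$, the empty partition included) such that $\lambda\subseteq R_{i_1}\cup R_{i_2}\cup\dots\cup R_{i_{m-1}}$ for some $i_1,\dots,i_{m-1}\in\{1,\dots,k\}$, not necessarily distinct. Then $Y^k_m$ is finite and has exactly $m^k$ elements. -/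

import Mathlib

/-! Partitions are identified with their Young diagrams (`YoungDiagram`), so that containment
`λ ⊂ μ` of partitions is the order `≤` of `YoungDiagram`. -/

namespace KYoung

/-- The parts of a partition, as a multiset of (positive) row lengths. -/
def parts (μ : YoungDiagram) : Multiset ℕ := (μ.rowLens : Multiset ℕ)

/-- The partition whose parts are the members of `s`, put into non-increasing order. -/
def ofParts (s : Multiset ℕ) : YoungDiagram :=
  YoungDiagram.ofRowLens (s.sort (· ≥ ·)) (s.pairwise_sort (· ≥ ·)).sortedGE

/-- The `k`-rectangle `R_i = (i^(k+1-i))`, for `1 ≤ i ≤ k`: it has `k + 1 - i` parts, all equal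
to `i`, so that its largest hook length is `k`. -/
def rect (k i : ℕ) : YoungDiagram := ofParts (Multiset.replicate (k + 1 - i) i)

/-- The union (stack) `μ_1 ∪ ⋯ ∪ μ_r` of partitions: combine all their parts and put them into
non-increasing order. -/
def stack {r : ℕ} (μ : Fin r → YoungDiagram) : YoungDiagram := ofParts (∑ j, parts (μ j))

/-- A partition is `k`-bounded if all its parts are at most `k`. -/
def IsKBounded (k : ℕ) (μ : YoungDiagram) : Prop := ∀ p ∈ parts μ, p ≤ k

/-- The set `Y^k_m` of the `k`-bounded partitions that are contained in a stack
`R_{i_1} ∪ ⋯ ∪ R_{i_{m-1}}` of `m - 1` of the `k`-rectangles (repetitions allowed). -/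
def Y (k m : ℕ) : Set YoungDiagram :=
  {μ | IsKBounded k μ ∧
    ∃ i : Fin (m - 1) → ℕ, (∀ j, 1 ≤ i j ∧ i j ≤ k) ∧ μ ≤ stack (fun j => rect k (i j))}

end KYoung

/-!
Encode a `k`-bounded partition by the multiplicities of its parts. Deleting the first column turns
`R_{i+1}` for `k + 1` into `R_i` for `k`, and makes `R_1` vanish. Inductively, the number of rows
by which a stack of `q` rectangles containing the shortened partition can exceed it is at most
`k * q - N`, a bound that is attained; here the demand `N` depends only on the partition. So at
least `Q = ⌈N / k⌉` of the rectangles must be wider than one column. Any further wide rectangle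
adds at most `k` to the excess, while `R_1` has `k + 1` rows, so it is best to use exactly `Q` wide
rectangles and to take all others equal to `R_1`. Hence the demand grows by `Q` plus the
multiplicity of the part `1`, and `q` rectangles suffice exactly when it is at most `(k + 1) * q`.

The number of multiplicity vectors with demand at most `k * q - e` is `q ^ e * (q + 1) ^ (k - e)`
for `e ≤ k`. Indeed, if `e < k` and the part `1` does not occur, then the first column can be
deleted, which lowers `k` by one; otherwise one part `1` can be removed, which raises `e` by one.
When `e` reaches `k`, lowering `q` by one resets `e` to `0`.
-/

namespace KYoung

open scoped Finset

theorem exists_card_fiber_eq {ι : Type*} [Fintype ι] [DecidableEq ι] {r : ℕ} (n : ι → ℕ)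
    (hn : ∑ x, n x = r) :
    ∃ i : Fin r → ι, ∀ x, #{j | i j = x} = n x := by
  let e : Fin r ≃ Σ x, Fin (n x) := (Fintype.equivFinOfCardEq (by simp [hn])).symm
  refine ⟨fun j => (e j).1, fun x => ?_⟩
  have hfiber : {j // (e j).1 = x} ≃ Fin (n x) :=
    (e.subtypeEquiv fun _ => Iff.rfl).trans (Equiv.sigmaSubtype x)
  rw [← Fintype.card_subtype, Fintype.card_congr hfiber, Fintype.card_fin]

theorem parts_ofParts {s : Multiset ℕ} (hs : ∀ p ∈ s, 0 < p) : parts (ofParts s) = s := by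
  rw [parts, ofParts, YoungDiagram.rowLens_ofRowLens_eq_self (by simpa using hs), s.sort_eq]

theorem ofParts_parts (μ : YoungDiagram) : ofParts (parts μ) = μ := by
  have hsort : (parts μ).sort (· ≥ ·) = μ.rowLens :=
    List.Perm.eq_of_pairwise' ((parts μ).pairwise_sort _) μ.rowLens_sorted.pairwise
      (Multiset.coe_eq_coe.1 ((parts μ).sort_eq _))
  simp only [ofParts, hsort, YoungDiagram.ofRowLens_to_rowLens_eq_self]

theorem pos_of_mem_parts {μ : YoungDiagram} {p : ℕ} (hp : p ∈ parts μ) : 0 < p :=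
  μ.pos_of_mem_rowLens p hp

theorem countP_lt_parts (μ : YoungDiagram) (v : ℕ) :
    (parts μ).countP (v < ·) = μ.colLen v := by
  have hrow (i : ℕ) : v < μ.rowLen i ↔ i < μ.colLen v := by
    rw [← YoungDiagram.mem_iff_lt_rowLen, YoungDiagram.mem_iff_lt_colLen]
  have hfilter : {i ∈ Finset.range (μ.colLen 0) | i < μ.colLen v} = Finset.range (μ.colLen v) := by
    have hle : μ.colLen v ≤ μ.colLen 0 := μ.colLen_anti 0 v v.zero_le
    ext i
    simp only [Finset.mem_filter, Finset.mem_range]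
    omega
  rw [parts, Multiset.coe_countP, YoungDiagram.rowLens, List.countP_map]
  simp only [Function.comp_def, hrow]
  rw [← Nat.count, Nat.count_eq_card_filter_range, hfilter, Finset.card_range]

theorem le_iff_colLen_le {μ ν : YoungDiagram} : μ ≤ ν ↔ ∀ v, μ.colLen v ≤ ν.colLen v := by
  simp only [← forall_lt_iff_le, ← YoungDiagram.mem_iff_lt_colLen]
  exact ⟨fun h v i hi => h hi, fun h ⟨i, v⟩ hi => h v hi⟩

variable {k : ℕ}

/-- The partition with `a x` parts equal to `x + 1`, for `x < k`. The `k`-bounded partitions are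
exactly those of this form. -/
def ofCounts (a : Fin k → ℕ) : YoungDiagram :=
  ofParts (∑ x, Multiset.replicate (a x) (x + 1 : ℕ))

theorem parts_ofCounts (a : Fin k → ℕ) :
    parts (ofCounts a) = ∑ x, Multiset.replicate (a x) (x + 1 : ℕ) := by
  refine parts_ofParts fun p hp => ?_
  obtain ⟨x, -, hx⟩ := Multiset.mem_sum.1 hp
  exact Multiset.eq_of_mem_replicate hx ▸ Nat.succ_pos _

theorem count_parts_ofCounts (a : Fin k → ℕ) (x : Fin k) :
    (parts (ofCounts a)).count (x + 1 : ℕ) = a x := by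
  simp [parts_ofCounts, Multiset.count_sum', Multiset.count_replicate, Fin.val_inj]

theorem ofCounts_injective : Function.Injective (ofCounts (k := k)) := fun a b h =>
  funext fun x => by rw [← count_parts_ofCounts a, h, count_parts_ofCounts]

theorem isKBounded_ofCounts (a : Fin k → ℕ) : IsKBounded k (ofCounts a) := by
  intro p hp
  rw [parts_ofCounts] at hp
  obtain ⟨x, -, hx⟩ := Multiset.mem_sum.1 hp
  exact Multiset.eq_of_mem_replicate hx ▸ x.2

theorem ofCounts_count_parts {μ : YoungDiagram} (hμ : IsKBounded k μ) :
    ofCounts (fun x : Fin k => (parts μ).count (x + 1 : ℕ)) = μ := by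
  refine (congrArg ofParts ?_).trans (ofParts_parts μ)
  ext p
  simp only [Multiset.count_sum', Multiset.count_replicate]
  by_cases hp : p ∈ parts μ
  · obtain ⟨x, rfl⟩ : ∃ x, p = x + 1 := Nat.exists_eq_succ_of_ne_zero (pos_of_mem_parts hp).ne'
    rw [Finset.sum_eq_single ⟨x, hμ _ hp⟩] <;> simp +contextual [Fin.ext_iff]
  · rw [Multiset.count_eq_zero.2 hp]
    refine Finset.sum_eq_zero fun x _ => ?_
    split_ifs with hx
    · exact Multiset.count_eq_zero.2 (hx ▸ hp)
    · rfl

theorem colLen_ofCounts (a : Fin k → ℕ) (v : ℕ) :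
    (ofCounts a).colLen v = ∑ x : Fin k, if v ≤ x then a x else 0 := by
  rw [← countP_lt_parts, parts_ofCounts, ← Multiset.coe_countPAddMonoidHom, map_sum]
  refine Finset.sum_congr rfl fun x _ => ?_
  simp [← Multiset.coe_replicate, List.countP_replicate]

theorem sum_le_sum_of_ofCounts_le {a b : Fin k → ℕ} (h : ofCounts a ≤ ofCounts b) :
    ∑ x, a x ≤ ∑ x, b x := by
  simpa [colLen_ofCounts] using le_iff_colLen_le.1 h 0

theorem sum_eq_add_sum_tail {M : Type*} [AddCommMonoid M] (a : Fin (k + 1) → M) :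
    ∑ x, a x = a 0 + ∑ x, Fin.tail a x :=
  Fin.sum_univ_succ a

theorem ofCounts_le_ofCounts_succ_iff {a b : Fin (k + 1) → ℕ} :
    ofCounts a ≤ ofCounts b ↔
      ∑ x, a x ≤ ∑ x, b x ∧ ofCounts (Fin.tail a) ≤ ofCounts (Fin.tail b) := by
  simp only [le_iff_colLen_le, colLen_ofCounts]
  rw [← Nat.and_forall_add_one]
  simp [Fin.sum_univ_succ, Fin.tail]

/-- The multiplicities of the parts of the stack of `n x` copies of the `k`-rectangle `R_{x+1}`,
for `x < k`. -/
def rectCounts (n : Fin k → ℕ) : Fin k → ℕ := fun x => (k - x) * n x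

theorem tail_rectCounts (n : Fin (k + 1) → ℕ) :
    Fin.tail (rectCounts n) = rectCounts (Fin.tail n) := by
  funext x
  simp [rectCounts, Fin.tail]

theorem sum_rectCounts_succ (n : Fin (k + 1) → ℕ) :
    ∑ x, rectCounts n x = (k + 1) * n 0 + ∑ x, rectCounts (Fin.tail n) x := by
  rw [sum_eq_add_sum_tail, tail_rectCounts]
  simp [rectCounts]

theorem stack_rect_succ {r : ℕ} (i : Fin r → Fin k) :
    stack (fun j => rect k (i j + 1)) =
      ofCounts (rectCounts fun x => #{j | i j = x}) := by
  have hparts (x : Fin k) : parts (rect k (x + 1)) = Multiset.replicate (k - x) (x + 1 : ℕ) := by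
    rw [rect, Nat.add_sub_add_right, parts_ofParts]
    intro p hp
    exact Multiset.eq_of_mem_replicate hp ▸ Nat.succ_pos _
  simp only [stack, ofCounts, hparts, rectCounts]
  rw [← Finset.sum_fiberwise' _ i fun x : Fin k => Multiset.replicate (k - x) (x + 1 : ℕ)]
  simp [Multiset.nsmul_replicate, mul_comm]

theorem ofCounts_mem_Y_iff {m : ℕ} {a : Fin k → ℕ} :
    ofCounts a ∈ Y k m ↔
      ∃ n : Fin k → ℕ, ∑ x, n x = m - 1 ∧ ofCounts a ≤ ofCounts (rectCounts n) := by
  constructor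
  · rintro ⟨-, i, hi, hle⟩
    obtain ⟨i, rfl⟩ : ∃ i' : Fin (m - 1) → Fin k, (fun j => (i' j + 1 : ℕ)) = i :=
      ⟨fun j => ⟨i j - 1, by grind⟩, by grind⟩
    refine ⟨_, ?_, stack_rect_succ i ▸ hle⟩
    simpa using Finset.sum_card_fiberwise_eq_card_filter Finset.univ Finset.univ i
  · rintro ⟨n, hn, hle⟩
    obtain ⟨i, hi⟩ := exists_card_fiber_eq n hn
    refine ⟨isKBounded_ofCounts a, fun j => i j + 1, fun j => ⟨Nat.succ_pos _, (i j).2⟩, ?_⟩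
    simpa only [stack_rect_succ, hi] using hle

/-- The largest surplus of rows over `ofCounts a` that a stack of `q` of the `k`-rectangles
containing `ofCounts a` can have is `k * q - demand a`; for `0 < k` such a stack exists exactly
when `demand a ≤ k * q`. The quotient is the least number of `k`-rectangles whose stack contains
the partition without its first column; for `k = 0` it is `0`, since `x ⌈/⌉ 0 = 0`. -/
def demand : {k : ℕ} → (Fin k → ℕ) → ℕ
  | 0, _ => 0
  | k + 1, a => a 0 + demand (Fin.tail a) + demand (Fin.tail a) ⌈/⌉ k

theorem demand_ceilDiv_le_iff {q : ℕ} (a : Fin k → ℕ) :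
    demand a ⌈/⌉ k ≤ q ↔ demand a ≤ k * q := by
  rcases k.eq_zero_or_pos with rfl | hk
  · simp [demand]
  · exact ceilDiv_le_iff_le_mul hk

theorem demand_add_sum_rectCounts_le {a n : Fin k → ℕ}
    (h : ofCounts a ≤ ofCounts (rectCounts n)) :
    demand a + ∑ x, rectCounts n x ≤ ∑ x, a x + k * ∑ x, n x := by
  induction k with
  | zero => simp [demand]
  | succ k ih =>
    have htail : ofCounts (Fin.tail a) ≤ ofCounts (rectCounts (Fin.tail n)) :=
      tail_rectCounts n ▸ (ofCounts_le_ofCounts_succ_iff.1 h).2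
    have hsurplus := ih htail
    have hceil : demand (Fin.tail a) ⌈/⌉ k ≤ ∑ x, Fin.tail n x := by
      have := sum_le_sum_of_ofCounts_le htail
      rw [demand_ceilDiv_le_iff]
      omega
    rw [sum_rectCounts_succ, sum_eq_add_sum_tail a, sum_eq_add_sum_tail n, demand]
    linarith

theorem demand_add_ceilDiv_add_le_iff {q e : ℕ} (he : e ≤ k) (a : Fin k → ℕ) :
    demand a + demand a ⌈/⌉ k + e ≤ (k + 1) * q ↔ demand a + e ≤ k * q := by
  constructor
  · intro h
    rcases le_or_gt q (demand a ⌈/⌉ k) with hq | hq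
    · linarith
    · calc demand a + e ≤ k * (demand a ⌈/⌉ k) + k :=
            Nat.add_le_add ((demand_ceilDiv_le_iff a).1 le_rfl) he
        _ = k * (demand a ⌈/⌉ k + 1) := by ring
        _ ≤ k * q := Nat.mul_le_mul_left k hq
  · intro h
    have hq : demand a ⌈/⌉ k ≤ q := (demand_ceilDiv_le_iff a).2 (by omega)
    linarith

theorem exists_ofCounts_le_of_demand_le {q : ℕ} (hk : k = 0 → q = 0) {a : Fin k → ℕ}
    (ha : demand a ≤ k * q) :
    ∃ n : Fin k → ℕ, ∑ x, n x = q ∧ ofCounts a ≤ ofCounts (rectCounts n) ∧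
      demand a + ∑ x, rectCounts n x = ∑ x, a x + k * q := by
  induction k generalizing q with
  | zero =>
    obtain rfl := hk rfl
    exact ⟨a, by simp, (congrArg ofCounts (Subsingleton.elim _ _)).le, by simp [demand]⟩
  | succ k ih =>
    set Q := demand (Fin.tail a) ⌈/⌉ k with hQ
    have hdemand : demand a = a 0 + demand (Fin.tail a) + Q := rfl
    obtain ⟨n, hn, hle, hsurplus⟩ := ih (q := Q) (by rintro rfl; simp [hQ])
      ((demand_ceilDiv_le_iff _).1 le_rfl)
    have hQq : Q ≤ q := by
      rw [demand_ceilDiv_le_iff, ← add_zero (demand _), ← demand_add_ceilDiv_add_le_iff k.zero_le]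
      omega
    obtain ⟨b, rfl⟩ := Nat.exists_eq_add_of_le' hQq
    have hsum : demand a + ∑ x, rectCounts (Fin.cons b n : Fin (k + 1) → ℕ) x =
        ∑ x, a x + (k + 1) * (b + Q) := by
      rw [sum_rectCounts_succ, sum_eq_add_sum_tail a, Fin.cons_zero, Fin.tail_cons]
      linarith
    refine ⟨Fin.cons b n, by simp [Fin.sum_univ_succ, hn], ?_, hsum⟩
    rw [ofCounts_le_ofCounts_succ_iff, tail_rectCounts, Fin.tail_cons]
    exact ⟨by omega, hle⟩

theorem exists_ofCounts_le_iff {q : ℕ} (hk : 0 < k) {a : Fin k → ℕ} :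
    (∃ n : Fin k → ℕ, ∑ x, n x = q ∧ ofCounts a ≤ ofCounts (rectCounts n)) ↔
      demand a ≤ k * q := by
  constructor
  · rintro ⟨n, rfl, hle⟩
    have hrows := sum_le_sum_of_ofCounts_le hle
    have hsurplus := demand_add_sum_rectCounts_le hle
    omega
  · intro ha
    obtain ⟨n, hn, hle, -⟩ := exists_ofCounts_le_of_demand_le (fun h => absurd h hk.ne') ha
    exact ⟨n, hn, hle⟩

theorem demand_add_single_zero (a : Fin (k + 1) → ℕ) :
    demand (a + Pi.single 0 1) = demand a + 1 := by
  have htail : Fin.tail (a + Pi.single 0 1) = Fin.tail a := by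
    funext x
    simp [Fin.tail]
  simp only [demand, htail, Pi.add_apply, Pi.single_eq_same]
  omega

/-- For `0 < k`, the multiplicities of the `k`-bounded partitions contained in a stack of `q` of the
`k`-rectangles that has at least `e` more rows than the partition. -/
def stackable (k q e : ℕ) : Set (Fin k → ℕ) := {a | demand a + e ≤ k * q}

theorem stackable_succ {q e : ℕ} (he : e ≤ k) :
    stackable (k + 1) q e =
      Fin.cons (α := fun _ => ℕ) 0 '' stackable k q e ∪
        (· + Pi.single 0 1) '' stackable (k + 1) q (e + 1) := by
  ext a
  constructor
  · intro ha
    rcases hd : a 0 with _ | d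
    · have hcons : Fin.cons 0 (Fin.tail a) = a := hd ▸ Fin.cons_self_tail a
      refine .inl ⟨Fin.tail a, (demand_add_ceilDiv_add_le_iff he _).1 ?_, hcons⟩
      simpa [stackable, demand, hd] using ha
    · have hadd : Fin.cons d (Fin.tail a) + Pi.single 0 1 = a :=
        funext (Fin.cases (by simp [hd]) fun x => by simp [Fin.tail])
      refine .inr ⟨Fin.cons d (Fin.tail a), ?_, hadd⟩
      rw [← hadd] at ha
      simp only [stackable, Set.mem_ofPred_eq, demand_add_single_zero] at ha ⊢
      omega
  · rintro (⟨b, hb, rfl⟩ | ⟨b, hb, rfl⟩)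
    · simpa [stackable, demand] using (demand_add_ceilDiv_add_le_iff he b).2 hb
    · simp only [stackable, Set.mem_ofPred_eq, demand_add_single_zero] at hb ⊢
      omega

theorem encard_stackable_succ {q e : ℕ} (he : e ≤ k) :
    (stackable (k + 1) q e).encard =
      (stackable k q e).encard + (stackable (k + 1) q (e + 1)).encard := by
  rw [stackable_succ he, Set.encard_union_eq, (Fin.cons_right_injective _).encard_image,
    (add_left_injective _).encard_image]
  rw [Set.disjoint_left]
  rintro _ ⟨a, -, rfl⟩ ⟨b, -, h⟩
  simpa using congrFun h 0

theorem stackable_zero_succ {e : ℕ} : stackable k 0 (e + 1) = ∅ := by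
  simp [stackable]

theorem stackable_succ_self {q : ℕ} : stackable k (q + 1) k = stackable k q 0 := by
  simp [stackable, mul_add]

theorem encard_stackable {q e : ℕ} (he : e ≤ k) :
    (stackable k q e).encard = (q ^ e * (q + 1) ^ (k - e) : ℕ) := by
  induction k generalizing q e with
  | zero =>
    obtain rfl : e = 0 := by omega
    simp [stackable, demand]
  | succ k ih =>
    have descend {q : ℕ} (htop : (stackable (k + 1) q (k + 1)).encard = (q ^ (k + 1) : ℕ)) {e : ℕ}
        (he : e ≤ k + 1) :
        (stackable (k + 1) q e).encard = (q ^ e * (q + 1) ^ (k + 1 - e) : ℕ) := by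
      induction he using Nat.decreasingInduction with
      | self => simpa using htop
      | of_succ e he ihe =>
        have hek : e ≤ k := Nat.le_of_lt_succ he
        rw [encard_stackable_succ hek, ih hek, ihe, Nat.succ_sub hek, Nat.add_sub_add_right]
        norm_cast
        rw [pow_succ, pow_succ]
        ring
    suffices htop : (stackable (k + 1) q (k + 1)).encard = (q ^ (k + 1) : ℕ) from descend htop he
    induction q with
    | zero => simp [stackable_zero_succ]
    | succ q ihq => simpa [stackable_succ_self] using descend ihq (Nat.zero_le _)

theorem Y_eq_image {m : ℕ} (hk : 0 < k) : Y k m = ofCounts '' stackable k (m - 1) 0 := by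
  have hmem (a : Fin k → ℕ) : ofCounts a ∈ Y k m ↔ a ∈ stackable k (m - 1) 0 :=
    ofCounts_mem_Y_iff.trans (exists_ofCounts_le_iff hk)
  ext μ
  constructor
  · intro hμ
    have hcounts := ofCounts_count_parts hμ.1
    exact ⟨_, (hmem _).1 (hcounts.symm ▸ hμ), hcounts⟩
  · rintro ⟨a, ha, rfl⟩
    exact (hmem a).2 ha

end KYoung

theorem mainTheorem3 (k m : ℕ) (hk : 0 < k) (hm : 1 < m) :
    (KYoung.Y k m).Finite ∧ (KYoung.Y k m).ncard = m ^ k := by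
  have hcard : (KYoung.Y k m).encard = (m ^ k : ℕ) := by
    rw [KYoung.Y_eq_image hk, KYoung.ofCounts_injective.encard_image,
      KYoung.encard_stackable k.zero_le]
    simp [Nat.sub_add_cancel hm.le]
  exact ⟨Set.finite_of_encard_eq_coe hcard, by rw [Set.ncard_def, hcard, ENat.toNat_natCast]⟩
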